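/- Notation. A \emph{neural network} is a finite sequence $\Phi=((W_1,B_1),\dots,(W_L,B_L))$, $L\ge 1$, with $W_k\in\mathbb{R}^{l_k\times l_{k-1}}$, $B_k\in\mathbb{R}^{l_k}$ and positive integers $l_0,\dots,l_L$. Its input dimension is $l_0$, its output dimension is $l_L$, $\mathcal{H}(\Phi)=L-1$ is its number of hidden layers, and $\mathcal{P}(\Phi)=\sum_{k=1}^L l_k(l_{k-1}+1)$ is its number of parameters. With the activation function $a(x)=\max\{x,0\}$, applied componentwise to vectors, its realization $\mathcal{R}_a(\Phi)\colon\mathbb{R}^{l_0}\to\mathbb{R}^{l_L}$ is given by $(\mathcal{R}_a(\Phi))(x_0)=W_Lx_{L-1}+B_L$, where $x_k=a(W_kx_{k-1}+B_k)$ for $1\le k<L$. Let $\|\cdot\|$ be the Euclidean norm. Proposition. Let $N,d\in\mathbb{N}=\{1,2,\dots\}$, $T\in(0,\infty)$, let $t_n=\frac{nT}{N}$ for $n\in\{0,1,\dots,N\}$, and let $\mathfrak{D}\in[1,\infty)$, $\varepsilon\in(0,1]$, $q\in(2,\infty)$ satisfy \[\mathfrak{D}=\Big[\tfrac{720q}{q-2}\Big]\big[\log_2(\varepsilon^{-1})+q+1\big]-504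 .\] Let $\Phi$ be a neural network with input and output dimension $d$, and let $Y=(Y_t^{x,y})\colon[0,T]\times\mathbb{R}^d\times(\mathbb{R}^d)^N\to\mathbb{R}^d$ be the function which satisfies for all $x\in\mathbb{R}^d$, $y=(y_1,\dots,y_N)\in(\mathbb{R}^d)^N$, $n\in\{0,\dots,N-1\}$, $t\in[t_n,t_{n+1}]$ that $Y_0^{x,y}=x$ and \[Y_t^{x,y}=Y_{t_n}^{x,y}+\big(\tfrac{tN}{T}-n\big)\Big[\tfrac{T}{N}(\mathcal{R}_a(\Phi))\big(Y_{t_n}^{x,y}\big)+y_{n+1}\Big].\] Then there exist neural networks $\Psi_y$, $y\in(\mathbb{R}^d)^N$, with input dimension $d+1$ and output dimension $d$, such that: (i) for all $y\in(\mathbb{R}^d)^N$, $\mathcal{R}_a(\Psi_y)\in C(\mathbb{R}^{d+1},\mathbb{R}^d)$; (ii) for all $n\in\{0,\dots,N-1\}$, $t\in[t_n,t_{n+1}]$, $x\in\mathbb{R}^d$, $y\in(\mathbb{R}^d)^N$, \[\|Y_t^{x,y}-(\mathcal{R}_a(\Psi_y))(t,x)\|\le\varepsilon\big(2\sqrt d+\|Y_{t_n}^{x,y}\|^q+\|Y_{t_{n+1}}^{x,y}\|^q\big);\]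 (iii) for all $n\in\{0,\dots,N-1\}$, $t\in[t_n,t_{n+1}]$, $x\in\mathbb{R}^d$, $y\in(\mathbb{R}^d)^N$, \[\|(\mathcal{R}_a(\Psi_y))(t,x)\|\le 6\sqrt d+2\big(\|Y_{t_n}^{x,y}\|^2+\|Y_{t_{n+1}}^{x,y}\|^2\big);\] (iv) for all $y\in(\mathbb{R}^d)^N$, \[\mathcal{P}(\Psi_y)\le\tfrac12\Big[6d^2N^2\mathcal{H}(\Phi)+3N\Big[d^2\mathfrak{D}+\big(23+6N\mathcal{H}(\Phi)+7d^2+N[4d^2+\mathcal{P}(\Phi)]^2\big)^2\Big]\Big]^2;\] (v) for all $t\in[0,T]$, $x\in\mathbb{R}^d$, the map $(\mathbb{R}^d)^N\ni y\mapsto(\mathcal{R}_a(\Psi_y))(t,x)\in\mathbb{R}^d$ is continuous; (vi) for all $n\in\{0,\dots,N\}$, $t\in[0,t_n]$, $x\in\mathbb{R}^d$ and all $y=(y_1,\dots,y_N)$, $z=(z_1,\dots,z_N)\in(\mathbb{R}^d)^N$ with $y_k=z_k$ for all $k\in\mathbb{N}$ with $k\le n$, \[(\mathcal{R}_a(\Psi_y))(t,x)=(\mathcal{R}_a(\Psi_z))(t,x).\]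 -/

import Mathlib

/-- `ANN m n` is the set of artificial neural networks with input dimension `m` and output
dimension `n`: the finite nonempty sequences `((W₁, B₁), …, (W_L, B_L))` of weight matrices
`W_k ∈ ℝ^(l_k × l_{k-1})` and bias vectors `B_k ∈ ℝ^(l_k)` with `l₀ = m`, `l_L = n` and all
dimensions `l₀, …, l_L` positive. `output W B` is the one-layer network `((W, B))`, and
`layer W B Φ` is the network `Φ` with the layer `(W, B)` put in front of it. -/
inductive ANN : ℕ → ℕ → Type
  | output {m n : ℕ} (hm : 0 < m) (hn : 0 < n)
      (W : Matrix (Fin n) (Fin m) ℝ) (B : Fin n → ℝ) : ANN m n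
  | layer {m k n : ℕ} (hm : 0 < m)
      (W : Matrix (Fin k) (Fin m) ℝ) (B : Fin k → ℝ) (Φ : ANN k n) : ANN m n

namespace ANN

/-- The number of layers `L`. -/
def length : {m n : ℕ} → ANN m n → ℕ
  | _, _, output _ _ _ _ => 1
  | _, _, layer _ _ _ Φ => Φ.length + 1

/-- The number of hidden layers `L - 1` (a genuine difference, since `L ≥ 1`). -/
def hidden {m n : ℕ} (Φ : ANN m n) : ℕ := Φ.length - 1

/-- The number of parameters `∑_{k=1}^L l_k (l_{k-1} + 1)`. -/
def params : {m n : ℕ} → ANN m n → ℕ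
  | m, n, output _ _ _ _ => n * (m + 1)
  | m, _, layer (k := k) _ _ _ Φ => k * (m + 1) + Φ.params

/-- The affine map `x ↦ W x + B`. -/
noncomputable def affine {m n : ℕ} (W : Matrix (Fin n) (Fin m) ℝ) (B : Fin n → ℝ)
    (x : EuclideanSpace ℝ (Fin m)) : EuclideanSpace ℝ (Fin n) :=
  WithLp.toLp 2 (W.mulVec x.ofLp + B)

/-- The componentwise application of `a : ℝ → ℝ` to a vector. -/
noncomputable def activate {n : ℕ} (a : ℝ → ℝ) (x : EuclideanSpace ℝ (Fin n)) :
    EuclideanSpace ℝ (Fin n) :=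
  WithLp.toLp 2 (fun i => a (x i))

/-- The realization of a network with activation function `a`, which is applied after every
affine map but the last one. -/
noncomputable def realize (a : ℝ → ℝ) : {m n : ℕ} → ANN m n →
    EuclideanSpace ℝ (Fin m) → EuclideanSpace ℝ (Fin n)
  | _, _, output _ _ W B, x => affine W B x
  | _, _, layer _ W B Φ, x => Φ.realize a (activate a (affine W B x))

end ANN

/-- The vector `(t, x) = (t, x₁, …, x_d) ∈ ℝ^(d+1)` for `t ∈ ℝ`, `x ∈ ℝ^d`. -/
noncomputable def timeSpace {d : ℕ} (t : ℝ) (x : EuclideanSpace ℝ (Fin d)) :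
    EuclideanSpace ℝ (Fin (d + 1)) :=
  WithLp.toLp 2 (Fin.cons t x.ofLp)

/-! On the grid cells the scheme is the linear interpolation of its grid values `Z k`, so `Y` at
time `s` is the sum over `k ≤ N` of `hat k (N s / T)` times `Z k`. The network evaluates this sum
with each product replaced by `prodApprox`.

The product comes from polarization and the sawtooth approximation of squares: `m` tent steps give
error at most `1 / 4 ^ (m + 1)` (`sqApprox_bounds`). Its second factor is truncated to `[-1/ε,
1/ε]`; beyond that range the loss is absorbed by `ε |y| ^ q` because `q > 2`
(`abs_mul_sub_prodApprox`). A zero hat gives exactly zero (`prodApprox_zero`), so at most two terms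
survive at any time. This makes the errors independent of `N` and gives exact nonanticipativity.

The sum is accumulated sequentially: the state consists of time, current grid value and partial sum,
and each block adds one product and then performs one Euler step through `Φ`
(`realizable_eulerState`). Old grid values are discarded, so the width does not grow with `N`, while
the depth is linear in `N`. Counting every layer as if it had maximal width is enough for the
parameter bound (`params_le`, `params_bound`). -/

/-- The rectified linear unit. -/
noncomputable def relu (x : ℝ) : ℝ := max x 0

theorem continuous_relu : Continuous relu := continuous_id.max continuous_const

theorem relu_of_nonneg {x : ℝ} (h : 0 ≤ x) : relu x = x := max_eq_left h

theorem relu_of_nonpos {x : ℝ} (h : x ≤ 0) : relu x = 0 := max_eq_right h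

theorem relu_sub_relu_neg (x : ℝ) : relu x - relu (-x) = x := by
  rcases le_total 0 x with h | h
  · rw [relu_of_nonneg h, relu_of_nonpos (by linarith), sub_zero]
  · rw [relu_of_nonpos h, relu_of_nonneg (by linarith)]; ring

theorem relu_add_relu_neg (x : ℝ) : relu x + relu (-x) = |x| := by
  rcases le_total 0 x with h | h
  · rw [relu_of_nonneg h, relu_of_nonpos (by linarith), abs_of_nonneg h, add_zero]
  · rw [relu_of_nonpos h, relu_of_nonneg (by linarith), abs_of_nonpos h, zero_add]

namespace ANN

/-! ### Widths, lengths and composition of networks -/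

/-- The largest of the layer dimensions `l₀, …, l_L`. -/
def width : {m n : ℕ} → ANN m n → ℕ
  | m, n, output _ _ _ _ => max m n
  | m, _, layer _ _ _ Φ => max m Φ.width

theorem input_pos : {m n : ℕ} → ANN m n → 0 < m
  | _, _, output hm _ _ _ => hm
  | _, _, layer hm _ _ _ => hm

theorem length_pos : {m n : ℕ} → (Φ : ANN m n) → 0 < Φ.length
  | _, _, output _ _ _ _ => Nat.one_pos
  | _, _, layer _ _ _ _ => Nat.succ_pos _

theorem input_le_width : {m n : ℕ} → (Φ : ANN m n) → m ≤ Φ.width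
  | _, _, output _ _ _ _ => le_max_left _ _
  | _, _, layer _ _ _ _ => le_max_left _ _

theorem params_le {m n : ℕ} (Φ : ANN m n) :
    Φ.params ≤ Φ.length * (Φ.width * (Φ.width + 1)) := by
  induction Φ with
  | output hm hn W B =>
    simp only [params, length, width, one_mul]
    gcongr <;> simp
  | @layer m k n hm W B Φ ih =>
    simp only [params, length, width]
    have h1 := Φ.input_le_width
    calc k * (m + 1) + Φ.params
        ≤ (max m Φ.width) * (max m Φ.width + 1) +
          Φ.length * (max m Φ.width * (max m Φ.width + 1)) := by
          gcongr
          · exact h1.trans (le_max_right _ _)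
          · exact le_max_left _ _
          · refine ih.trans ?_
            gcongr <;> exact le_max_right _ _
      _ = _ := by ring

theorem width_le_params {m n : ℕ} (Φ : ANN m n) : Φ.width ≤ Φ.params := by
  induction Φ with
  | output hm hn W B =>
    simp only [params, width]
    refine max_le ?_ ?_ <;> nlinarith
  | layer hm W B Φ ih =>
    simp only [params, width]
    have := Φ.input_pos
    refine max_le ?_ (by omega)
    nlinarith

theorem continuous_affine {m n : ℕ} (W : Matrix (Fin n) (Fin m) ℝ) (B : Fin n → ℝ) :
    Continuous (affine W B) := by
  unfold affine
  fun_prop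

theorem continuous_activate {n : ℕ} {a : ℝ → ℝ} (ha : Continuous a) :
    Continuous (activate (n := n) a) := by
  unfold activate
  fun_prop

theorem continuous_realize {m n : ℕ} (Φ : ANN m n) {a : ℝ → ℝ} (ha : Continuous a) :
    Continuous (Φ.realize a) := by
  induction Φ with
  | output hm hn W B => exact continuous_affine W B
  | layer hm W B Φ ih => exact ih.comp ((continuous_activate ha).comp (continuous_affine W B))

theorem affine_affine {m k n : ℕ} (W : Matrix (Fin k) (Fin m) ℝ) (B : Fin k → ℝ)
    (V : Matrix (Fin n) (Fin k) ℝ) (C : Fin n → ℝ) (x : EuclideanSpace ℝ (Fin m)) :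
    affine V C (affine W B x) = affine (V * W) (V.mulVec B + C) x := by
  simp only [affine, Matrix.mulVec_add, Matrix.mulVec_mulVec, add_assoc]

/-- The network `Φ` applied to the affine image `W x + B`. -/
noncomputable def precomp {m k : ℕ} (hm : 0 < m) (W : Matrix (Fin k) (Fin m) ℝ)
    (B : Fin k → ℝ) : {n : ℕ} → ANN k n → ANN m n
  | _, output _ hn V C => output hm hn (V * W) (V.mulVec B + C)
  | _, layer _ V C Φ => layer hm (V * W) (V.mulVec B + C) Φ

/-- The composition of two networks, in which the output layer of the first one is merged with
the first layer of the second one. -/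
noncomputable def comp : {m k n : ℕ} → ANN m k → ANN k n → ANN m n
  | _, _, _, output hm _ W B, Φ => Φ.precomp hm W B
  | _, _, _, layer hm W B Ψ, Φ => layer hm W B (Ψ.comp Φ)

theorem length_precomp {m k n : ℕ} (hm : 0 < m) (W : Matrix (Fin k) (Fin m) ℝ) (B : Fin k → ℝ)
    (Φ : ANN k n) : (Φ.precomp hm W B).length = Φ.length := by
  cases Φ <;> rfl

theorem width_precomp {m k n : ℕ} (hm : 0 < m) (W : Matrix (Fin k) (Fin m) ℝ) (B : Fin k → ℝ)
    (Φ : ANN k n) : (Φ.precomp hm W B).width ≤ max m Φ.width := by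
  cases Φ <;> simp only [precomp, width] <;> omega

theorem realize_precomp {m k n : ℕ} (hm : 0 < m) (W : Matrix (Fin k) (Fin m) ℝ) (B : Fin k → ℝ)
    (Φ : ANN k n) (a : ℝ → ℝ) (x : EuclideanSpace ℝ (Fin m)) :
    (Φ.precomp hm W B).realize a x = Φ.realize a (affine W B x) := by
  cases Φ <;> simp only [precomp, realize, affine_affine]

/-- Merging two adjacent affine maps saves one layer, so numbers of hidden layers add. -/
theorem length_comp {m k n : ℕ} (Ψ : ANN m k) (Φ : ANN k n) :
    (Ψ.comp Φ).length + 1 = Ψ.length + Φ.length := by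
  induction Ψ with
  | output hm hn W B => simp only [comp, length_precomp, length]; omega
  | layer hm W B Ψ ih => have := ih Φ; simp only [comp, length]; omega

theorem width_comp {m k n : ℕ} (Ψ : ANN m k) (Φ : ANN k n) :
    (Ψ.comp Φ).width ≤ max Ψ.width Φ.width := by
  induction Ψ with
  | output hm hn W B =>
    refine (width_precomp hm W B Φ).trans ?_
    simp only [width]; omega
  | layer hm W B Ψ ih => have := ih Φ; simp only [comp, width]; omega

theorem realize_comp {m k n : ℕ} (Ψ : ANN m k) (Φ : ANN k n) (a : ℝ → ℝ)
    (x : EuclideanSpace ℝ (Fin m)) :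
    (Ψ.comp Φ).realize a x = Φ.realize a (Ψ.realize a x) := by
  induction Ψ with
  | output hm hn W B => exact realize_precomp hm W B Φ a x
  | layer hm W B Ψ ih => exact ih Φ _

end ANN

/-! ### Functions realized by networks of given width and depth -/

/-- A real-valued affine function of finitely many real variables. -/
def IsAff {ι : Type} [Fintype ι] (f : (ι → ℝ) → ℝ) : Prop :=
  ∃ (w : ι → ℝ) (b : ℝ), ∀ x, f x = ∑ j, w j * x j + b

namespace IsAff

variable {ι : Type} [Fintype ι] {f g : (ι → ℝ) → ℝ}

theorem const (c : ℝ) : IsAff fun _ : ι → ℝ => c := ⟨0, c, by simp⟩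

theorem coord (i : ι) : IsAff fun x : ι → ℝ => x i := by
  classical exact ⟨Pi.single i 1, 0, by simp [Pi.single_apply]⟩

theorem add (hf : IsAff f) (hg : IsAff g) : IsAff fun x => f x + g x := by
  obtain ⟨w, b, h⟩ := hf
  obtain ⟨v, c, h'⟩ := hg
  refine ⟨w + v, b + c, fun x => ?_⟩
  simp only [h, h', Pi.add_apply, add_mul, Finset.sum_add_distrib]
  ring

theorem const_mul (c : ℝ) (hf : IsAff f) : IsAff fun x => c * f x := by
  obtain ⟨w, b, h⟩ := hf
  refine ⟨c • w, c * b, fun x => ?_⟩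
  simp only [h, mul_add, Finset.mul_sum, Pi.smul_apply, smul_eq_mul, mul_assoc]

theorem neg (hf : IsAff f) : IsAff fun x => -f x := by
  simpa using hf.const_mul (-1)

theorem sub (hf : IsAff f) (hg : IsAff g) : IsAff fun x => f x - g x := by
  simpa only [sub_eq_add_neg] using hf.add hg.neg

theorem sum {κ : Type} (s : Finset κ) {F : κ → (ι → ℝ) → ℝ} (h : ∀ k, IsAff (F k)) :
    IsAff fun x => ∑ k ∈ s, F k x := by
  classical
  induction s using Finset.induction_on with
  | empty => simpa using const 0
  | insert a s ha ih => simpa only [Finset.sum_insert ha] using (h a).add ih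

end IsAff

/-- `f` is realized by a network with at most `L` hidden layers, all of whose layer dimensions
are at most `w`. -/
def Realizable {ι κ : Type} (w L : ℕ) (f : (ι → ℝ) → κ → ℝ) : Prop :=
  ∀ ⦃m n : ℕ⦄ (e : ι ≃ Fin m) (e' : κ ≃ Fin n), ∃ Φ : ANN m n,
    Φ.length ≤ L + 1 ∧ Φ.width ≤ w ∧
      ∀ x, Φ.realize relu (WithLp.toLp 2 (x ∘ e.symm)) = WithLp.toLp 2 (f x ∘ e'.symm)

namespace Realizable

variable {ι κ η : Type} {w L L' : ℕ}

theorem mono {w' : ℕ} {f : (ι → ℝ) → κ → ℝ} (hf : Realizable w L f) (hw : w ≤ w')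
    (hL : L ≤ L') : Realizable w' L' f := fun _ _ e e' => by
  obtain ⟨Φ, h1, h2, h3⟩ := hf e e'
  exact ⟨Φ, by omega, by omega, h3⟩

theorem of_isAff [Fintype ι] [Fintype κ] [Nonempty ι] [Nonempty κ] {f : (ι → ℝ) → κ → ℝ}
    (hf : ∀ i, IsAff fun x => f x i) (hι : Fintype.card ι ≤ w) (hκ : Fintype.card κ ≤ w) :
    Realizable w 0 f := fun m n e e' => by
  choose W b h using hf
  have hm : Fintype.card ι = m := by simpa using Fintype.card_congr e
  have hn : Fintype.card κ = n := by simpa using Fintype.card_congr e'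
  have hm0 : 0 < m := hm ▸ Fintype.card_pos
  have hn0 : 0 < n := hn ▸ Fintype.card_pos
  refine ⟨ANN.output hm0 hn0 (Matrix.of fun i j => W (e'.symm i) (e.symm j))
    (fun i => b (e'.symm i)), le_rfl, ?_, fun x => ?_⟩
  · simp only [ANN.width]; omega
  · ext i
    simp only [ANN.realize, ANN.affine, Matrix.mulVec, dotProduct, Matrix.of_apply,
      Function.comp_apply, Pi.add_apply, h]
    rw [e.symm.sum_comp (fun j => W (e'.symm i) j * x j)]

theorem relu [Fintype ι] [Nonempty ι] (hι : Fintype.card ι ≤ w) :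
    Realizable w 1 fun (x : ι → ℝ) i => relu (x i) := fun m n e e' => by
  have hm : Fintype.card ι = m := by simpa using Fintype.card_congr e
  have hn : Fintype.card ι = n := by simpa using Fintype.card_congr e'
  have hm0 : 0 < m := hm ▸ Fintype.card_pos
  have hn0 : 0 < n := hn ▸ Fintype.card_pos
  refine ⟨ANN.layer hm0 1 0 (ANN.output hm0 hn0
    (Matrix.of fun i j => if j = e (e'.symm i) then 1 else 0) 0), le_rfl, ?_, fun x => ?_⟩
  · simp only [ANN.width]; omega
  · ext i
    simp [ANN.realize, ANN.affine, ANN.activate, Matrix.mulVec, dotProduct]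

theorem comp [Finite κ] {f : (ι → ℝ) → κ → ℝ} {g : (κ → ℝ) → η → ℝ}
    (hg : Realizable w L' g) (hf : Realizable w L f) :
    Realizable w (L + L') fun x => g (f x) := fun m n e e' => by
  obtain ⟨k, ⟨c⟩⟩ := Finite.exists_equiv_fin κ
  obtain ⟨Ψ, h1, h2, h3⟩ := hf e c
  obtain ⟨Φ, h1', h2', h3'⟩ := hg c e'
  refine ⟨Ψ.comp Φ, ?_, (Ψ.width_comp Φ).trans (max_le h2 h2'), fun x => ?_⟩
  · have := Ψ.length_comp Φ; omega
  · rw [ANN.realize_comp, h3, h3']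

theorem iterate [Fintype ι] [Nonempty ι] {f : (ι → ℝ) → ι → ℝ} (hf : Realizable w L f)
    (hι : Fintype.card ι ≤ w) (k : ℕ) : Realizable w (k * L) (f^[k]) := by
  induction k with
  | zero => exact (of_isAff (f := id) IsAff.coord hι hι).mono le_rfl (Nat.zero_le _)
  | succ k ih =>
    have := hf.comp ih
    rw [Function.iterate_succ', add_mul, one_mul]
    exact this

end Realizable

/-- A linear combination of `r` rectified affine functions. -/
def ReluSum {ι : Type} [Fintype ι] (r : ℕ) (f : (ι → ℝ) → ℝ) : Prop :=
  ∃ (c : Fin r → ℝ) (l : Fin r → (ι → ℝ) → ℝ), (∀ j, IsAff (l j)) ∧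
    ∀ x, f x = ∑ j, c j * relu (l j x)

namespace ReluSum

variable {ι κ : Type} [Fintype ι] [Fintype κ] {r s w : ℕ} {f g : (ι → ℝ) → ℝ}

theorem add (hf : ReluSum r f) (hg : ReluSum s g) : ReluSum (r + s) fun x => f x + g x := by
  obtain ⟨c, l, hl, h⟩ := hf
  obtain ⟨c', l', hl', h'⟩ := hg
  refine ⟨Fin.append c c', Fin.append l l', fun j => ?_, fun x => ?_⟩
  · induction j using Fin.addCases with
    | left j => simpa using hl j
    | right j => simpa using hl' j
  · simp [Fin.sum_univ_add, h, h']

theorem zero (r : ℕ) : ReluSum r fun _ : ι → ℝ => 0 :=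
  ⟨0, fun _ _ => 0, fun _ => IsAff.const 0, by simp⟩

/-- Padding with zero coefficients lets all components of one layer use the same number of summands.
-/
theorem mono (hf : ReluSum r f) (h : r ≤ s) : ReluSum s f := by
  obtain ⟨k, rfl⟩ := Nat.exists_eq_add_of_le h
  simpa using hf.add (zero k)

theorem const_mul (c : ℝ) (hf : ReluSum r f) : ReluSum r fun x => c * f x := by
  obtain ⟨b, l, hl, h⟩ := hf
  exact ⟨c • b, l, hl, fun x => by simp [h, Finset.mul_sum, mul_assoc]⟩

theorem relu (hf : IsAff f) : ReluSum 1 fun x => relu (f x) :=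
  ⟨fun _ => 1, fun _ => f, fun _ => hf, by simp⟩

theorem of_isAff (hf : IsAff f) : ReluSum 2 f := by
  convert (relu hf).add ((relu hf.neg).const_mul (-1)) using 2 with x
  linarith [relu_sub_relu_neg (f x)]

theorem realizable [Nonempty ι] [Nonempty κ] {F : (ι → ℝ) → κ → ℝ} (hr : 0 < r)
    (hF : ∀ i, ReluSum r fun x => F x i) (hι : Fintype.card ι ≤ w)
    (hκ : r * Fintype.card κ ≤ w) : Realizable w 1 F := by
  choose c l hl h using hF
  have : Nonempty (Fin r) := ⟨⟨0, hr⟩⟩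
  have hη : Fintype.card (κ × Fin r) ≤ w := by
    rw [Fintype.card_prod, Fintype.card_fin, mul_comm]; exact hκ
  have hκ' : Fintype.card κ ≤ w := (Nat.le_mul_of_pos_left _ hr).trans hκ
  have h1 : Realizable w 0 fun (x : ι → ℝ) (p : κ × Fin r) => l p.1 p.2 x :=
    Realizable.of_isAff (fun p => hl p.1 p.2) hι hη
  have h3 : Realizable w 0 fun (z : κ × Fin r → ℝ) (i : κ) => ∑ j, c i j * z (i, j) :=
    Realizable.of_isAff
      (fun i => IsAff.sum _ fun j => (IsAff.coord (i, j)).const_mul (c i j)) hη hκ'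
  have := h3.comp ((Realizable.relu hη).comp h1)
  convert this using 3 with x i
  exact h i x

end ReluSum

theorem ReluSum.abs {ι : Type} [Fintype ι] {f : (ι → ℝ) → ℝ} (hf : IsAff f) :
    ReluSum 2 fun x => |f x| := by
  convert (ReluSum.relu hf).add (ReluSum.relu hf.neg) using 2 with x
  exact (relu_add_relu_neg (f x)).symm

/-- A network can carry the additional variables indexed by `C` through its layers. -/
theorem ANN.realizable_carry {m n : ℕ} (Φ : ANN m n) {C : Type} [Fintype C] {w : ℕ}
    (hw : 2 * (Φ.width + Fintype.card C) ≤ w) :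
    Realizable w (Φ.length - 1) fun x : Fin m ⊕ C → ℝ =>
      Sum.elim (Φ.realize relu (WithLp.toLp 2 (x ∘ Sum.inl))).ofLp (x ∘ Sum.inr) := by
  induction Φ with
  | @output m n hm hn W B =>
    have : Nonempty (Fin m) := ⟨⟨0, hm⟩⟩
    have : Nonempty (Fin n) := ⟨⟨0, hn⟩⟩
    simp only [width] at hw
    refine Realizable.of_isAff (fun i => ?_) ?_ ?_
    · rcases i with i | i
      · exact (IsAff.sum Finset.univ fun j =>
          (IsAff.coord (Sum.inl j : Fin m ⊕ C)).const_mul (W i j)).add (IsAff.const (B i))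
      · exact IsAff.coord (Sum.inr i)
    · rw [Fintype.card_sum, Fintype.card_fin]; omega
    · rw [Fintype.card_sum, Fintype.card_fin]; omega
  | @layer m k n hm W B Φ ih =>
    have : Nonempty (Fin m) := ⟨⟨0, hm⟩⟩
    have : Nonempty (Fin k) := ⟨⟨0, Φ.input_pos⟩⟩
    have hk := Φ.input_le_width
    have hl := Φ.length_pos
    simp only [width] at hw
    have h1 : Realizable w 1 fun x : Fin m ⊕ C → ℝ => (Sum.elim
        (fun i => _root_.relu ((∑ j, W i j * x (Sum.inl j)) + B i)) (x ∘ Sum.inr) :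
        Fin k ⊕ C → ℝ) := by
      refine ReluSum.realizable two_pos (fun i => ?_) ?_ ?_
      · rcases i with i | i
        · exact (ReluSum.relu ((IsAff.sum _ fun j =>
            (IsAff.coord (Sum.inl j)).const_mul (W i j)).add (IsAff.const (B i)))).mono (by simp)
        -- A carried variable passes the activation as `relu x - relu (-x)`; this is why the width
        -- is doubled.
        · exact ReluSum.of_isAff (IsAff.coord (Sum.inr i))
      · rw [Fintype.card_sum, Fintype.card_fin]; omega
      · rw [Fintype.card_sum, Fintype.card_fin]; omega
    have h2 := ih (by omega)
    refine (h2.comp h1).mono le_rfl ?_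
    simp only [length]; omega

/-! ### The approximate product -/

/-- A piecewise linear function which is the tent map on `[0, 1]`. -/
noncomputable def tent (g : ℝ) : ℝ := 2 * relu g + -4 * relu (g - 1 / 2)

/-- One step of the iteration which computes approximate squares. -/
noncomputable def tentStep (p : ℝ × ℝ) : ℝ × ℝ := (tent p.1, 4 * p.2 + tent p.1)

/-- The approximation of `u ^ 2` for `u ∈ [0, 1]` after `m` steps. -/
noncomputable def sqApprox (m : ℕ) (u : ℝ) : ℝ := -(tentStep^[m] (u, -u)).2 / 4 ^ m

/-- The truncation of `y` to `[-R, R]`. -/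
noncomputable def clip (R y : ℝ) : ℝ := relu (y + R) + -1 * relu (y - R) + -R

/-- The hat function with peak `1` at `k` and support `[k - 1, k + 1]`. -/
noncomputable def hat (k s : ℝ) : ℝ :=
  relu (s - (k - 1)) + -2 * relu (s - k) + relu (s - (k + 1))

/-- The approximation of the product `h * y` for `h ∈ [0, 1]`. -/
noncomputable def prodApprox (m : ℕ) (R h y : ℝ) : ℝ :=
  R * (sqApprox m |1 / (2 * R) * clip R y + 1 / 2 * h| -
    sqApprox m |1 / (2 * R) * clip R y - 1 / 2 * h|)

/-- The simultaneous iteration step for a family of variables. -/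
noncomputable def tentMap {C κ : Type} (x : C ⊕ (κ ⊕ κ) → ℝ) : C ⊕ (κ ⊕ κ) → ℝ :=
  Sum.elim (fun i => x (Sum.inl i)) (Sum.elim (fun i => tent (x (Sum.inr (Sum.inl i))))
    (fun i => 4 * x (Sum.inr (Sum.inr i)) + tent (x (Sum.inr (Sum.inl i)))))

theorem tentMap_iterate {C κ : Type} (s : C → ℝ) (p : κ → ℝ × ℝ) (m : ℕ) :
    tentMap^[m] (Sum.elim s (Sum.elim (fun i => (p i).1) (fun i => (p i).2))) =
      Sum.elim s (Sum.elim (fun i => (tentStep^[m] (p i)).1) (fun i => (tentStep^[m] (p i)).2)) := by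
  induction m with
  | zero => rfl
  | succ m ih =>
    rw [Function.iterate_succ_apply', ih]
    simp only [Function.iterate_succ_apply']
    rfl

theorem ReluSum.tent {ι : Type} [Fintype ι] {f : (ι → ℝ) → ℝ} (hf : IsAff f) :
    ReluSum 2 fun x => tent (f x) :=
  ((ReluSum.relu hf).const_mul 2).add ((ReluSum.relu (hf.sub (IsAff.const _))).const_mul (-4))

theorem realizable_tentMap {C κ : Type} [Fintype C] [Fintype κ] [Nonempty C] {w : ℕ}
    (hw : 4 * (Fintype.card C + (Fintype.card κ + Fintype.card κ)) ≤ w) :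
    Realizable w 1 (tentMap (C := C) (κ := κ)) := by
  have hc : Fintype.card (C ⊕ (κ ⊕ κ)) =
    Fintype.card C + (Fintype.card κ + Fintype.card κ) := by simp
  refine ReluSum.realizable (r := 4) (by simp) (fun i => ?_) (by omega) (by omega)
  rcases i with i | i | i
  · exact (ReluSum.of_isAff (IsAff.coord (Sum.inl i))).mono (by simp)
  · exact (ReluSum.tent (IsAff.coord (Sum.inr (Sum.inl i)))).mono (by simp)
  · exact (ReluSum.of_isAff ((IsAff.coord (Sum.inr (Sum.inr i))).const_mul 4)).add
      (ReluSum.tent (IsAff.coord (Sum.inr (Sum.inl i))))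

/-! ### The recursion for the interpolated Euler scheme -/

/-- The variables of the network: the rescaled time, the current grid value of the scheme, and
the part of the interpolation computed so far. -/
abbrev StateIdx (d : ℕ) : Type := Unit ⊕ (Fin d ⊕ Fin d)

/-- The state with the given components. -/
def mkState {d : ℕ} (s : ℝ) (Y A : Fin d → ℝ) : StateIdx d → ℝ :=
  Sum.elim (fun _ => s) (Sum.elim Y A)

/-- One hidden layer computes hats and truncations, one the absolute values, and `m` the tent steps.
The tent layers are the widest: `4 * (6 * d + 1) ≤ 28 * d` neurons, as `d ≥ 1`. -/
theorem realizable_prodStep {d : ℕ} (hd : 0 < d) (m : ℕ) (R k : ℝ) {w : ℕ} (hw : 28 * d ≤ w) :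
    Realizable w (m + 2) fun x : StateIdx d → ℝ => mkState (x (Sum.inl ()))
      (fun i => x (Sum.inr (Sum.inl i)))
      (fun i => x (Sum.inr (Sum.inr i)) +
        prodApprox m R (hat k (x (Sum.inl ()))) (x (Sum.inr (Sum.inl i)))) := by
  have h1 : Realizable w 1 fun x : StateIdx d → ℝ => (Sum.elim x (Sum.elim
      (fun _ => hat k (x (Sum.inl ()))) (fun i => clip R (x (Sum.inr (Sum.inl i))))) :
      StateIdx d ⊕ (Unit ⊕ Fin d) → ℝ) := by
    refine ReluSum.realizable (r := 4) (by simp) (fun i => ?_) ?_ ?_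
    · have ht := IsAff.coord (Sum.inl () : StateIdx d)
      rcases i with i | i | i
      · exact (ReluSum.of_isAff (IsAff.coord i)).mono (by simp)
      · exact (((ReluSum.relu (ht.sub (IsAff.const _))).add
          ((ReluSum.relu (ht.sub (IsAff.const _))).const_mul (-2))).add
          (ReluSum.relu (ht.sub (IsAff.const _)))).mono (by simp)
      · have hy := IsAff.coord (Sum.inr (Sum.inl i) : StateIdx d)
        exact ((ReluSum.relu (hy.add (IsAff.const _))).add
          ((ReluSum.relu (hy.sub (IsAff.const _))).const_mul (-1))).add
          (ReluSum.of_isAff (IsAff.const _))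
    · simp; omega
    · simp; omega
  -- The Boolean selects the sign in the polarization identity; the pairs `(u, -u)` are the starting
  -- values of the square iteration.
  have h2 : Realizable w 1 fun z : StateIdx d ⊕ (Unit ⊕ Fin d) → ℝ => (Sum.elim
      (fun i => z (Sum.inl i)) (Sum.elim
        (fun p => |1 / (2 * R) * z (Sum.inr (Sum.inr p.1)) +
          (if p.2 then 1 / 2 else -(1 / 2)) * z (Sum.inr (Sum.inl ()))|)
        (fun p => -1 * |1 / (2 * R) * z (Sum.inr (Sum.inr p.1)) +
          (if p.2 then 1 / 2 else -(1 / 2)) * z (Sum.inr (Sum.inl ()))|)) :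
      StateIdx d ⊕ ((Fin d × Bool) ⊕ (Fin d × Bool)) → ℝ) := by
    refine ReluSum.realizable (r := 2) (by simp) (fun i => ?_) ?_ ?_
    · rcases i with i | i | i
      · exact ReluSum.of_isAff (IsAff.coord (Sum.inl i))
      · exact ReluSum.abs (((IsAff.coord _).const_mul _).add ((IsAff.coord _).const_mul _))
      · exact (ReluSum.abs
          (((IsAff.coord _).const_mul _).add ((IsAff.coord _).const_mul _))).const_mul (-1)
    · simp; omega
    · simp; omega
  have h3 : Realizable w (m * 1) (tentMap (C := StateIdx d) (κ := Fin d × Bool))^[m] :=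
    (realizable_tentMap (by simp; omega)).iterate (by simp; omega) m
  have h4 : Realizable w 0 fun z : StateIdx d ⊕ ((Fin d × Bool) ⊕ (Fin d × Bool)) → ℝ =>
      mkState (z (Sum.inl (Sum.inl ()))) (fun i => z (Sum.inl (Sum.inr (Sum.inl i))))
        (fun i => z (Sum.inl (Sum.inr (Sum.inr i))) +
          (-R / 4 ^ m * z (Sum.inr (Sum.inr (i, true))) +
            R / 4 ^ m * z (Sum.inr (Sum.inr (i, false))))) := by
    refine Realizable.of_isAff (fun i => ?_) ?_ ?_
    · rcases i with i | i | i
      · exact IsAff.coord _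
      · exact IsAff.coord _
      · exact (IsAff.coord _).add (((IsAff.coord _).const_mul _).add ((IsAff.coord _).const_mul _))
    · simp; omega
    · simp; omega
  have h := h4.comp (h3.comp (h2.comp h1))
  convert h.mono le_rfl (show 1 + 1 + m * 1 + 0 ≤ m + 2 by omega) using 2 with x
  have key := tentMap_iterate x (fun p : Fin d × Bool =>
    (|1 / (2 * R) * clip R (x (Sum.inr (Sum.inl p.1))) +
      (if p.2 then 1 / 2 else -(1 / 2)) * hat k (x (Sum.inl ()))|,
    -1 * |1 / (2 * R) * clip R (x (Sum.inr (Sum.inl p.1))) +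
      (if p.2 then 1 / 2 else -(1 / 2)) * hat k (x (Sum.inl ()))|)) m
  simp only [Sum.elim_inl, Sum.elim_inr]
  rw [key]
  simp only [Sum.elim_inl, Sum.elim_inr]
  congr 1
  funext i
  simp only [prodApprox, sqApprox, if_true, Bool.false_eq_true, if_false, neg_mul,
    ← sub_eq_add_neg]
  ring_nf

theorem realizable_eulerStep {d : ℕ} (hd : 0 < d) (Φ : ANN d d) (c : ℝ) (v : Fin d → ℝ)
    {w : ℕ} (hw : 6 * d + 2 + 2 * Φ.width ≤ w) :
    Realizable w (Φ.length - 1) fun x : StateIdx d → ℝ => mkState (x (Sum.inl ()))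
      (fun i => x (Sum.inr (Sum.inl i)) +
        (c * Φ.realize relu (WithLp.toLp 2 fun i => x (Sum.inr (Sum.inl i))) i + v i))
      (fun i => x (Sum.inr (Sum.inr i))) := by
  have h1 : Realizable w 0 fun x : StateIdx d → ℝ => (Sum.elim
      (fun i => x (Sum.inr (Sum.inl i))) x : Fin d ⊕ StateIdx d → ℝ) := by
    refine Realizable.of_isAff (fun i => ?_) ?_ ?_
    · rcases i with i | i
      · exact IsAff.coord _
      · exact IsAff.coord _
    · simp; omega
    · simp; omega
  have h2 := Φ.realizable_carry (C := StateIdx d) (w := w) (by simp; omega)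
  have h3 : Realizable w 0 fun z : Fin d ⊕ StateIdx d → ℝ =>
      mkState (z (Sum.inr (Sum.inl ())))
        (fun i => z (Sum.inr (Sum.inr (Sum.inl i))) + (c * z (Sum.inl i) + v i))
        (fun i => z (Sum.inr (Sum.inr (Sum.inr i)))) := by
    refine Realizable.of_isAff (fun i => ?_) ?_ ?_
    · rcases i with i | i | i
      · exact IsAff.coord _
      · exact (IsAff.coord _).add (((IsAff.coord _).const_mul c).add (IsAff.const _))
      · exact IsAff.coord _
    · simp; omega
    · simp; omega
  have h := h3.comp (h2.comp h1)
  exact h.mono le_rfl (by omega)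

/-- The grid values of the Euler-type scheme with drift `F`, step size `c` and increments `y`. -/
noncomputable def eulerGrid {d N : ℕ}
    (F : EuclideanSpace ℝ (Fin d) → EuclideanSpace ℝ (Fin d)) (c : ℝ)
    (y : Fin N → EuclideanSpace ℝ (Fin d)) (x : EuclideanSpace ℝ (Fin d)) :
    ℕ → EuclideanSpace ℝ (Fin d)
  | 0 => x
  | n + 1 => eulerGrid F c y x n +
      (c • F (eulerGrid F c y x n) + if h : n < N then y ⟨n, h⟩ else 0)

theorem realizable_eulerState {d N : ℕ} (hd : 0 < d) (m : ℕ) (R c b : ℝ) (Φ : ANN d d)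
    (y : Fin N → EuclideanSpace ℝ (Fin d)) {w : ℕ} (hw : 28 * d + 2 * Φ.width ≤ w) (n : ℕ) :
    Realizable w (n * (m + 2 + (Φ.length - 1))) fun x : Fin (d + 1) → ℝ =>
      mkState (b * x 0)
        (eulerGrid (Φ.realize relu) c y (WithLp.toLp 2 fun i => x i.succ) n).ofLp
        (fun i => ∑ k ∈ Finset.range n, prodApprox m R (hat k (b * x 0))
          (eulerGrid (Φ.realize relu) c y (WithLp.toLp 2 fun i => x i.succ) k i)) := by
  induction n with
  | zero =>
    refine Realizable.mono (Realizable.of_isAff (fun i => ?_) ?_ ?_) le_rfl (Nat.zero_le _)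
    · rcases i with i | i | i
      · exact (IsAff.coord _).const_mul b
      · exact IsAff.coord i.succ
      · exact IsAff.const 0
    · simp; omega
    · simp; omega
  | succ n ih =>
    -- The product is added before the Euler step, while the state still holds grid value `n`.
    have h1 := realizable_prodStep hd m R n (w := w) (by omega)
    have h2 := realizable_eulerStep hd Φ c
      (if h : n < N then y ⟨n, h⟩ else 0 : EuclideanSpace ℝ (Fin d)).ofLp (w := w) (by omega)
    have h := h2.comp (h1.comp ih)
    convert h.mono le_rfl
      (show _ ≤ (n + 1) * (m + 2 + (Φ.length - 1)) by rw [add_mul, one_mul]; omega) using 2 with x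
    simp only [Finset.sum_range_succ]
    rfl

theorem exists_ann_eulerInterpolation {d N : ℕ} (hd : 0 < d) (m : ℕ) (R c b : ℝ) (Φ : ANN d d)
    (y : Fin N → EuclideanSpace ℝ (Fin d)) :
    ∃ Ψ : ANN (d + 1) d, Ψ.length ≤ (N + 1) * (m + 2 + Φ.hidden) + 1 ∧
      Ψ.width ≤ 28 * d + 2 * Φ.width ∧ ∀ (s : ℝ) (x : EuclideanSpace ℝ (Fin d)) (i : Fin d),
        Ψ.realize relu (timeSpace s x) i = ∑ k ∈ Finset.range (N + 1),
          prodApprox m R (hat k (b * s)) (eulerGrid (Φ.realize relu) c y x k i) := by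
  have : Nonempty (Fin d) := ⟨⟨0, hd⟩⟩
  -- The terms `0, …, N` require `N + 1` blocks. The Euler step of the last block uses the default
  -- increment `0`, and its result is thrown away.
  have h1 := realizable_eulerState hd m R c b Φ y le_rfl (N + 1)
  have h2 : Realizable (28 * d + 2 * Φ.width) 0 fun x : StateIdx d → ℝ =>
      fun i : Fin d => x (Sum.inr (Sum.inr i)) := by
    refine Realizable.of_isAff (fun i => IsAff.coord _) ?_ ?_
    · simp; omega
    · simp; omega
  obtain ⟨Ψ, hl, hw, h⟩ := h2.comp h1 (Equiv.refl _) (Equiv.refl _)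
  refine ⟨Ψ, hl, hw, fun s x i => ?_⟩
  have := congrArg (fun v : EuclideanSpace ℝ (Fin d) => v i) (h (Fin.cons s x.ofLp))
  simpa [mkState, timeSpace] using this

/-! ### Error bounds for the approximate product -/

theorem tent_eq_of_le {u : ℝ} (h0 : 0 ≤ u) (h : u ≤ 1 / 2) : tent u = 2 * u := by
  rw [tent, relu_of_nonneg h0, relu_of_nonpos (by linarith)]; ring

theorem tent_eq_of_ge {u : ℝ} (h : 1 / 2 ≤ u) : tent u = 2 - 2 * u := by
  rw [tent, relu_of_nonneg (by linarith), relu_of_nonneg (by linarith)]; ring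

/-- On `[0, 1]` the tent map `g` satisfies `4 u (1 - u) = g u + g u (1 - g u)`, so each step
multiplies the invariant by `4`. -/
theorem tentStep_iterate (m : ℕ) {p : ℝ × ℝ} (h0 : 0 ≤ p.1) (h1 : p.1 ≤ 1) :
    0 ≤ (tentStep^[m] p).1 ∧ (tentStep^[m] p).1 ≤ 1 ∧
      (tentStep^[m] p).2 + (tentStep^[m] p).1 * (1 - (tentStep^[m] p).1) =
        4 ^ m * (p.2 + p.1 * (1 - p.1)) := by
  induction m with
  | zero => simp [h0, h1]
  | succ m ih =>
    rw [Function.iterate_succ_apply']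
    obtain ⟨h0, h1, h⟩ := ih
    rw [pow_succ', mul_assoc, ← h]
    generalize tentStep^[m] p = z at *
    rcases le_total z.1 (1 / 2) with h' | h'
    · simp only [tentStep, tent_eq_of_le h0 h']
      refine ⟨by linarith, by linarith, by ring⟩
    · simp only [tentStep, tent_eq_of_ge h']
      refine ⟨by linarith, by linarith, by ring⟩

theorem sqApprox_bounds (m : ℕ) {u : ℝ} (h0 : 0 ≤ u) (h1 : u ≤ 1) :
    u ^ 2 ≤ sqApprox m u ∧ sqApprox m u ≤ u ^ 2 + 1 / 4 ^ (m + 1) := by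
  obtain ⟨g0, g1, h⟩ := tentStep_iterate m (p := (u, -u)) h0 h1
  have h4 : (0 : ℝ) < 4 ^ m := by positivity
  rw [sqApprox]
  generalize tentStep^[m] (u, -u) = z at *
  -- The start `(u, -u)` has invariant `-u ^ 2`; the error is therefore `z.1 * (1 - z.1) / 4 ^ m`,
  -- with numerator in `[0, 1/4]`.
  have hz : -z.2 = 4 ^ m * u ^ 2 + z.1 * (1 - z.1) := by linear_combination -h
  rw [hz, add_div, mul_div_cancel_left₀ _ h4.ne']
  refine ⟨?_, ?_⟩
  · have : 0 ≤ z.1 * (1 - z.1) / 4 ^ m := by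
      apply div_nonneg (mul_nonneg g0 _) h4.le
      linarith
    linarith
  · have : z.1 * (1 - z.1) / 4 ^ m ≤ (1 / 4) / 4 ^ m := by
      gcongr
      nlinarith [sq_nonneg (z.1 - 1 / 2)]
    rw [pow_succ' (4 : ℝ) m]
    rw [div_div] at this
    linarith

theorem clip_bounds {R : ℝ} (hR : 0 ≤ R) (y : ℝ) :
    |clip R y| ≤ R ∧ |clip R y| ≤ |y| ∧ |y - clip R y| ≤ |y| ∧ (|y| ≤ R → clip R y = y) := by
  unfold clip
  rcases le_total y (-R) with h | h
  · rw [relu_of_nonpos (by linarith), relu_of_nonpos (by linarith), abs_of_nonpos (by linarith),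
      abs_of_nonpos (by linarith), abs_of_nonpos (by linarith)]
    refine ⟨by linarith, by linarith, by linarith, fun _ => by linarith⟩
  · rcases le_total R y with h' | h'
    · rw [relu_of_nonneg (by linarith), relu_of_nonneg (by linarith), abs_of_nonneg (by linarith),
        abs_of_nonneg (by linarith), abs_of_nonneg (by linarith)]
      refine ⟨by linarith, by linarith, by linarith, fun _ => by linarith⟩
    · rw [relu_of_nonneg (by linarith), relu_of_nonpos (by linarith)]
      have e : y + R + -1 * 0 + -R = y := by ring
      rw [e, sub_self, abs_zero]
      exact ⟨abs_le.2 ⟨h, h'⟩, le_rfl, abs_nonneg _, fun _ => rfl⟩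

/-- For `h = 0` the two approximate squares have the same argument and cancel. -/
theorem prodApprox_zero (m : ℕ) (R y : ℝ) : prodApprox m R 0 y = 0 := by
  simp [prodApprox]

/-- Polarization with both arguments scaled into `[0, 1]`. The square errors are one-sided, so their
difference costs only one error term. -/
theorem abs_prodApprox_sub_clip (m : ℕ) {R h : ℝ} (hR : 0 < R) (h0 : 0 ≤ h) (h1 : h ≤ 1)
    (y : ℝ) : |prodApprox m R h y - h * clip R y| ≤ R / 4 ^ (m + 1) := by
  have hc : |1 / (2 * R) * clip R y| ≤ 1 / 2 := by
    rw [abs_mul, abs_of_pos (by positivity : 0 < 1 / (2 * R))]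
    calc 1 / (2 * R) * |clip R y| ≤ 1 / (2 * R) * R := by
          gcongr; exact (clip_bounds hR.le y).1
      _ = 1 / 2 := by field_simp
  have hh : h * clip R y = R * (|1 / (2 * R) * clip R y + 1 / 2 * h| ^ 2 -
      |1 / (2 * R) * clip R y - 1 / 2 * h| ^ 2) := by
    rw [sq_abs, sq_abs]; field_simp; ring
  rw [hh, prodApprox]
  rw [abs_le] at hc
  obtain ⟨a1, a2⟩ := sqApprox_bounds m (abs_nonneg (1 / (2 * R) * clip R y + 1 / 2 * h))
    (abs_le.2 ⟨by linarith, by linarith⟩)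
  obtain ⟨b1, b2⟩ := sqApprox_bounds m (abs_nonneg (1 / (2 * R) * clip R y - 1 / 2 * h))
    (abs_le.2 ⟨by linarith, by linarith⟩)
  rw [← mul_sub, abs_mul, abs_of_pos hR, ← mul_one_div R]
  gcongr
  rw [abs_le]
  constructor <;> linarith

theorem abs_mul_sub_prodApprox {m : ℕ} {ε q h : ℝ} (hε0 : 0 < ε) (hε1 : ε ≤ 1) (hq : 2 < q)
    (hm : ε⁻¹ ≤ 2 ^ m) (h0 : 0 ≤ h) (h1 : h ≤ 1) (y : ℝ) :
    |h * y - prodApprox m ε⁻¹ h y| ≤ ε + ε * |y| ^ q ∧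
      |prodApprox m ε⁻¹ h y| ≤ 3 + 2 * |y| ^ (2 : ℝ) := by
  have hR : 0 < ε⁻¹ := inv_pos.2 hε0
  have herr : |prodApprox m ε⁻¹ h y - h * clip ε⁻¹ y| ≤ ε := by
    refine (abs_prodApprox_sub_clip m hR h0 h1 y).trans ?_
    rw [div_le_iff₀ (by positivity)]
    have h4 : (4 : ℝ) ^ (m + 1) = 4 * (2 ^ m * 2 ^ m) := by
      rw [← mul_pow, pow_succ']; norm_num
    have hp : ε⁻¹ * ε⁻¹ ≤ (2 : ℝ) ^ m * 2 ^ m := by gcongr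
    have he : ε⁻¹ = ε * (ε⁻¹ * ε⁻¹) := by field_simp
    rw [h4]
    calc ε⁻¹ = ε * (ε⁻¹ * ε⁻¹) := he
      _ ≤ ε * (4 * (2 ^ m * 2 ^ m)) :=
        mul_le_mul_of_nonneg_left (by linarith [mul_pos hR hR]) hε0.le
  obtain ⟨-, c2, c3, c4⟩ := clip_bounds hR.le y
  constructor
  · have hy : |y - clip ε⁻¹ y| ≤ ε * |y| ^ q := by
      -- Truncation matters only if `|y| ≥ 1/ε ≥ 1`, and then `|y| ≤ ε |y| ^ 2 ≤ ε |y| ^ q`.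
      rcases le_total |y| ε⁻¹ with hl | hl
      · rw [c4 hl, sub_self, abs_zero]; positivity
      · refine c3.trans ?_
        have hy1 : 1 ≤ |y| := ((one_le_inv₀ hε0).2 hε1).trans hl
        have hy2 : |y| ^ (2 : ℝ) ≤ |y| ^ q := Real.rpow_le_rpow_of_exponent_le hy1 hq.le
        rw [Real.rpow_two] at hy2
        have hy3 : 1 ≤ ε * |y| := by
          have := mul_le_mul_of_nonneg_left hl hε0.le
          rwa [mul_inv_cancel₀ hε0.ne'] at this
        calc |y| ≤ (ε * |y|) * |y| := le_mul_of_one_le_left (abs_nonneg _) hy3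
          _ = ε * |y| ^ 2 := by ring
          _ ≤ _ := by gcongr
    have e : h * y - prodApprox m ε⁻¹ h y =
        h * (y - clip ε⁻¹ y) - (prodApprox m ε⁻¹ h y - h * clip ε⁻¹ y) := by ring
    rw [e]
    refine (abs_sub _ _).trans ?_
    rw [abs_mul, abs_of_nonneg h0]
    have := mul_le_of_le_one_left (abs_nonneg (y - clip ε⁻¹ y)) h1
    linarith
  · have e : prodApprox m ε⁻¹ h y =
        (prodApprox m ε⁻¹ h y - h * clip ε⁻¹ y) + h * clip ε⁻¹ y := by ring
    rw [e, Real.rpow_two]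
    refine (abs_add_le _ _).trans ?_
    rw [abs_mul, abs_of_nonneg h0]
    have := mul_le_of_le_one_left (abs_nonneg (clip ε⁻¹ y)) h1
    nlinarith [sq_nonneg (|y| - 1)]

theorem continuous_tentStep : Continuous tentStep := by
  unfold tentStep tent
  have := continuous_relu
  fun_prop

theorem continuous_sqApprox (m : ℕ) : Continuous (sqApprox m) := by
  unfold sqApprox
  have := continuous_tentStep.iterate m
  fun_prop

theorem continuous_prodApprox (m : ℕ) (R h : ℝ) : Continuous (prodApprox m R h) := by
  unfold prodApprox clip
  have := continuous_relu
  have := continuous_sqApprox m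
  fun_prop

/-! ### Hat functions on the grid and norm estimates -/

theorem hat_left {k s : ℝ} (h : k ≤ s) (h' : s ≤ k + 1) : hat k s = 1 - (s - k) := by
  rw [hat, relu_of_nonneg (by linarith), relu_of_nonneg (by linarith),
    relu_of_nonpos (by linarith)]
  ring

theorem hat_right {k s : ℝ} (h : k ≤ s) (h' : s ≤ k + 1) : hat (k + 1) s = s - k := by
  rw [hat, relu_of_nonneg (by linarith), relu_of_nonpos (by linarith),
    relu_of_nonpos (by linarith)]
  ring

theorem hat_of_le {k s : ℝ} (h : s + 1 ≤ k) : hat k s = 0 := by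
  rw [hat, relu_of_nonpos (by linarith), relu_of_nonpos (by linarith),
    relu_of_nonpos (by linarith)]
  ring

theorem hat_of_ge {k s : ℝ} (h : k + 1 ≤ s) : hat k s = 0 := by
  rw [hat, relu_of_nonneg (by linarith), relu_of_nonneg (by linarith),
    relu_of_nonneg (by linarith)]
  ring

theorem sum_hat {N n : ℕ} (hn : n < N) {s : ℝ} (h : (n : ℝ) ≤ s) (h' : s ≤ n + 1)
    {f : ℝ → ℕ → ℝ} (hf : ∀ k, f 0 k = 0) :
    ∑ k ∈ Finset.range (N + 1), f (hat k s) k = f (1 - (s - n)) n + f (s - n) (n + 1) := by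
  have hsub : ({n, n + 1} : Finset ℕ) ⊆ Finset.range (N + 1) := by
    intro k hk
    simp only [Finset.mem_insert, Finset.mem_singleton] at hk
    rw [Finset.mem_range]; omega
  rw [← Finset.sum_subset hsub, Finset.sum_pair (by omega), hat_left h h', Nat.cast_add_one,
    hat_right h h']
  intro k _ hk
  simp only [Finset.mem_insert, Finset.mem_singleton, not_or] at hk
  rcases lt_or_gt_of_ne hk.1 with hl | hl
  · have : (k : ℝ) + 1 ≤ n := by exact_mod_cast hl
    rw [hat_of_ge (by linarith), hf]
  · have hl' : n + 2 ≤ k := by omega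
    have : (n : ℝ) + 2 ≤ k := by exact_mod_cast hl'
    rw [hat_of_le (by linarith), hf]

/-- Componentwise bounds by powers give bounds of the Euclidean norm. -/
theorem EuclideanSpace.norm_le_of_abs_le_rpow {d : ℕ} {α β q : ℝ} (hα : 0 ≤ α) (hβ : 0 ≤ β)
    (hq : 1 ≤ q) {v y : EuclideanSpace ℝ (Fin d)} (h : ∀ i, |v i| ≤ α + β * |y i| ^ q) :
    ‖v‖ ≤ α * Real.sqrt d + β * ‖y‖ ^ q := by
  set e : EuclideanSpace ℝ (Fin d) := WithLp.toLp 2 fun _ => 1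
  set z : EuclideanSpace ℝ (Fin d) := WithLp.toLp 2 fun i => |y i| ^ q
  have he : ‖e‖ = Real.sqrt d := by simp [e, EuclideanSpace.norm_eq]
  -- Factor `|y i| ^ q = |y i| * |y i| ^ (q - 1)` and bound the second factor by `‖y‖ ^ (q - 1)`;
  -- this avoids a dimensional constant.
  have hz : ‖z‖ ≤ ‖y‖ ^ q := by
    refine le_of_sq_le_sq ?_ (by positivity)
    rw [EuclideanSpace.norm_sq_eq]
    have hy := EuclideanSpace.norm_sq_eq y
    calc ∑ i, ‖z i‖ ^ 2 ≤ ∑ i, ‖y i‖ ^ 2 * (‖y‖ ^ (q - 1)) ^ 2 := by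
          refine Finset.sum_le_sum fun i _ => ?_
          have h1 : z i = |y i| ^ q := rfl
          have h2 : |y i| ^ q = |y i| * |y i| ^ (q - 1) := by
            rw [← Real.rpow_one_add' (abs_nonneg _) (by linarith)]; congr 1; ring
          have h3 : |y i| ≤ ‖y‖ := PiLp.norm_apply_le y i
          rw [h1, h2, Real.norm_eq_abs, Real.norm_eq_abs, ← mul_pow, abs_mul, abs_abs,
            abs_of_nonneg (Real.rpow_nonneg (abs_nonneg _) _)]
          gcongr
      _ = (‖y‖ * ‖y‖ ^ (q - 1)) ^ 2 := by rw [← Finset.sum_mul, ← hy, mul_pow]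
      _ = (‖y‖ ^ q) ^ 2 := by
          rw [← Real.rpow_one_add' (norm_nonneg _) (by linarith)]
          congr 2; ring
  calc ‖v‖ ≤ ‖α • e + β • z‖ := by
        rw [EuclideanSpace.norm_eq, EuclideanSpace.norm_eq]
        refine Real.sqrt_le_sqrt (Finset.sum_le_sum fun i _ => ?_)
        gcongr
        refine (h i).trans (le_of_eq_of_le ?_ (Real.le_norm_self _))
        simp [e, z]
    _ ≤ ‖α • e‖ + ‖β • z‖ := norm_add_le _ _
    _ ≤ α * Real.sqrt d + β * ‖y‖ ^ q := by
        rw [norm_smul, norm_smul, Real.norm_of_nonneg hα, Real.norm_of_nonneg hβ, he]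
        gcongr

/-! ### The grid values of the scheme -/

theorem continuous_eulerGrid {d N : ℕ} {F : EuclideanSpace ℝ (Fin d) → EuclideanSpace ℝ (Fin d)}
    (hF : Continuous F) (c : ℝ) (x : EuclideanSpace ℝ (Fin d)) (n : ℕ) :
    Continuous fun y : Fin N → EuclideanSpace ℝ (Fin d) => eulerGrid F c y x n := by
  induction n with
  | zero => exact continuous_const
  | succ n ih =>
    simp only [eulerGrid]
    refine ih.add (((hF.comp ih).const_smul c).add ?_)
    split_ifs with h
    · exact continuous_apply _
    · exact continuous_const

theorem eulerGrid_congr {d N : ℕ} (F : EuclideanSpace ℝ (Fin d) → EuclideanSpace ℝ (Fin d))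
    (c : ℝ) (x : EuclideanSpace ℝ (Fin d)) {y z : Fin N → EuclideanSpace ℝ (Fin d)} {n : ℕ}
    (h : ∀ k : Fin N, (k : ℕ) < n → y k = z k) : eulerGrid F c y x n = eulerGrid F c z x n := by
  induction n with
  | zero => rfl
  | succ n ih =>
    simp only [eulerGrid]
    rw [ih fun k hk => h k (by omega)]
    split_ifs with hn
    · rw [h ⟨n, hn⟩ (Nat.lt_succ_self n)]
    · rfl

/-! ### The number of parameters -/

theorem params_bound {N d m H P D : ℝ} (hN : 1 ≤ N) (hd : 1 ≤ d) (hm : 0 ≤ m) (hH : 0 ≤ H)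
    (hP : 1 ≤ P) (hD : 720 * (m + 1) ≤ D) :
    ((N + 1) * (m + 2 + H) + 1) * ((28 * d + 2 * P) * (28 * d + 2 * P + 1)) ≤
      1 / 2 * (6 * d ^ 2 * N ^ 2 * H + 3 * N * (d ^ 2 * D +
        (23 + 6 * N * H + 7 * d ^ 2 + N * (4 * d ^ 2 + P) ^ 2) ^ 2)) ^ 2 := by
  have hd2 : d ≤ d ^ 2 := by nlinarith
  have hd1 : 1 ≤ d ^ 2 := hd.trans hd2
  have hNH : H ≤ N * H := le_mul_of_one_le_left hH hN
  set B := (4 * d ^ 2 + P) ^ 2 with hB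
  have hB1 : 1 ≤ B := one_le_pow₀ (by linarith)
  have hNB : B ≤ N * B := le_mul_of_one_le_left (by linarith) hN
  have hw : (28 * d + 2 * P) * (28 * d + 2 * P + 1) ≤ 64 * B := by
    calc (28 * d + 2 * P) * (28 * d + 2 * P + 1)
        ≤ (8 * (4 * d ^ 2 + P)) * (8 * (4 * d ^ 2 + P)) := by
          apply mul_le_mul <;> linarith
      _ = 64 * B := by rw [hB]; ring
  have hl : (N + 1) * (m + 2 + H) + 1 ≤ N * (5 * (m + 1 + H)) := by
    have : m + 2 + H ≤ N * (m + 2 + H) := le_mul_of_one_le_left (by linarith) hN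
    have : 0 ≤ N * m := by positivity
    have : 0 ≤ N * H := by positivity
    linarith
  set A := 23 + 6 * N * H + 7 * d ^ 2 + N * B with hA
  have hA1 : 23 + H + B ≤ A := by
    have : 0 ≤ N * H := by positivity
    linarith
  -- The cross terms `46 B` and `2 H B` of `(23 + H + B) ^ 2` suffice; twelve copies of the latter
  -- exceed `23 H B`.
  have hA2 : 23 * (1 + H) * B ≤ A ^ 2 * 12 := by
    have h1 : (23 + H + B) ^ 2 ≤ A ^ 2 := by gcongr
    have h2 : 0 ≤ H * B := by positivity
    linarith [sq_nonneg H, sq_nonneg B]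
  have hD0 : 0 < D := by linarith
  have hX : 3 * N * (D + A ^ 2) ≤ 6 * d ^ 2 * N ^ 2 * H + 3 * N * (d ^ 2 * D + A ^ 2) := by
    have h1 : 0 ≤ 6 * d ^ 2 * N ^ 2 * H := by positivity
    have h2 : D ≤ d ^ 2 * D := le_mul_of_one_le_left hD0.le hd1
    have h3 : 3 * N * (D + A ^ 2) ≤ 3 * N * (d ^ 2 * D + A ^ 2) := by gcongr
    linarith
  calc ((N + 1) * (m + 2 + H) + 1) * ((28 * d + 2 * P) * (28 * d + 2 * P + 1))
      ≤ (N * (5 * (m + 1 + H))) * (64 * B) := by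
        apply mul_le_mul hl hw <;> positivity
    _ ≤ (N * (5 * ((m + 1) * (1 + H)))) * (64 * B) := by
        gcongr; linarith [mul_nonneg hm hH]
    _ = N * (320 * (m + 1)) * ((1 + H) * B) := by ring
    _ ≤ N * D * A ^ 2 := by
        have h1 : 320 * (m + 1) * ((1 + H) * B) ≤ D * A ^ 2 := by
          calc 320 * (m + 1) * ((1 + H) * B)
              ≤ 320 * (m + 1) * (A ^ 2 * 12 / 23) := by gcongr; linarith
            _ ≤ (720 * (m + 1)) * A ^ 2 := by
              have : 0 ≤ (m + 1) * A ^ 2 := by positivity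
              linarith
            _ ≤ _ := by gcongr
        calc _ = N * (320 * (m + 1) * ((1 + H) * B)) := by ring
          _ ≤ N * (D * A ^ 2) := by gcongr
          _ = _ := by ring
    _ ≤ 1 / 2 * (3 * N * (D + A ^ 2)) ^ 2 := by
        have h1 : D * A ^ 2 ≤ (D + A ^ 2) ^ 2 := by
          have : 0 ≤ D * A ^ 2 := by positivity
          linarith [sq_nonneg D, sq_nonneg (A ^ 2)]
        have h2 : N ≤ N ^ 2 := by nlinarith
        calc N * D * A ^ 2 = N * (D * A ^ 2) := by ring
          _ ≤ N ^ 2 * (D + A ^ 2) ^ 2 := by gcongr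
          _ ≤ 1 / 2 * (3 * N * (D + A ^ 2)) ^ 2 := by
            have : 0 ≤ N ^ 2 * (D + A ^ 2) ^ 2 := by positivity
            linarith
    _ ≤ _ := by gcongr

/-- Take `m` to be the ceiling of `log₂ (1/ε)`. Since `q / (q - 2) ≥ 1` and `q + 1 ≥ 3`, the slack
of `720` over `720 (m + 1)` covers the subtracted `504`. -/
theorem depth_bound {ε q D : ℝ} (hε0 : 0 < ε) (hε1 : ε ≤ 1) (hq : 2 < q)
    (hD : D = 720 * q / (q - 2) * (Real.logb 2 ε⁻¹ + q + 1) - 504) :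
    ∃ m : ℕ, ε⁻¹ ≤ 2 ^ m ∧ 720 * ((m : ℝ) + 1) ≤ D := by
  have hl : 0 ≤ Real.logb 2 ε⁻¹ := Real.logb_nonneg one_lt_two ((one_le_inv₀ hε0).2 hε1)
  refine ⟨⌈Real.logb 2 ε⁻¹⌉₊, ?_, ?_⟩
  · rw [← Real.rpow_natCast, ← Real.logb_le_iff_le_rpow one_lt_two (inv_pos.2 hε0)]
    exact Nat.le_ceil _
  · have h1 := Nat.ceil_lt_add_one hl
    have h2 : 720 ≤ 720 * q / (q - 2) := by
      rw [le_div_iff₀ (by linarith)]; linarith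
    have h3 : 720 * (Real.logb 2 ε⁻¹ + 3) ≤
        720 * q / (q - 2) * (Real.logb 2 ε⁻¹ + q + 1) := by
      apply mul_le_mul h2 <;> linarith
    linarith

/-! ### Assembly of the networks and their properties -/

theorem mainTheorem4 (N d : ℕ) (hN : 0 < N) (hd : 0 < d)
    (a : ℝ → ℝ) (ha : ∀ x : ℝ, a x = max x 0)
    (T : ℝ) (hT : 0 < T)
    (t : Fin (N + 1) → ℝ) (ht : ∀ n : Fin (N + 1), t n = (n : ℕ) * T / N)
    (D ε q : ℝ) (hD1 : 1 ≤ D) (hε0 : 0 < ε) (hε1 : ε ≤ 1) (hq : 2 < q)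
    (hD : D = 720 * q / (q - 2) * (Real.logb 2 ε⁻¹ + q + 1) - 504)
    (Φ : ANN d d)
    (Y : ℝ → EuclideanSpace ℝ (Fin d) → (Fin N → EuclideanSpace ℝ (Fin d)) →
      EuclideanSpace ℝ (Fin d))
    (hY0 : ∀ (x : EuclideanSpace ℝ (Fin d)) (y : Fin N → EuclideanSpace ℝ (Fin d)), Y 0 x y = x)
    (hY : ∀ (n : Fin N), ∀ s ∈ Set.Icc (t n.castSucc) (t n.succ),
      ∀ (x : EuclideanSpace ℝ (Fin d)) (y : Fin N → EuclideanSpace ℝ (Fin d)),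
        Y s x y = Y (t n.castSucc) x y +
          (s * N / T - (n : ℕ)) • ((T / N) • Φ.realize a (Y (t n.castSucc) x y) + y n)) :
    ∃ Ψ : (Fin N → EuclideanSpace ℝ (Fin d)) → ANN (d + 1) d,
      (∀ y, Continuous ((Ψ y).realize a)) ∧
      (∀ (n : Fin N), ∀ s ∈ Set.Icc (t n.castSucc) (t n.succ),
        ∀ (x : EuclideanSpace ℝ (Fin d)) (y : Fin N → EuclideanSpace ℝ (Fin d)),
          ‖Y s x y - (Ψ y).realize a (timeSpace s x)‖ ≤
            ε * (2 * Real.sqrt d + ‖Y (t n.castSucc) x y‖ ^ q + ‖Y (t n.succ) x y‖ ^ q)) ∧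
      (∀ (n : Fin N), ∀ s ∈ Set.Icc (t n.castSucc) (t n.succ),
        ∀ (x : EuclideanSpace ℝ (Fin d)) (y : Fin N → EuclideanSpace ℝ (Fin d)),
          ‖(Ψ y).realize a (timeSpace s x)‖ ≤
            6 * Real.sqrt d + 2 * (‖Y (t n.castSucc) x y‖ ^ 2 + ‖Y (t n.succ) x y‖ ^ 2)) ∧
      (∀ y, ((Ψ y).params : ℝ) ≤
        1 / 2 * (6 * (d : ℝ) ^ 2 * (N : ℝ) ^ 2 * Φ.hidden +
          3 * N * ((d : ℝ) ^ 2 * D +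
            (23 + 6 * N * Φ.hidden + 7 * (d : ℝ) ^ 2 +
              N * (4 * (d : ℝ) ^ 2 + Φ.params) ^ 2) ^ 2)) ^ 2) ∧
      (∀ s ∈ Set.Icc (0 : ℝ) T, ∀ x : EuclideanSpace ℝ (Fin d),
        Continuous (fun y : Fin N → EuclideanSpace ℝ (Fin d) =>
          (Ψ y).realize a (timeSpace s x))) ∧
      (∀ (n : Fin (N + 1)), ∀ s ∈ Set.Icc (0 : ℝ) (t n),
        ∀ (x : EuclideanSpace ℝ (Fin d)) (y z : Fin N → EuclideanSpace ℝ (Fin d)),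
          (∀ k : Fin N, (k : ℕ) < (n : ℕ) → y k = z k) →
            (Ψ y).realize a (timeSpace s x) = (Ψ z).realize a (timeSpace s x)) := by
  obtain rfl : a = relu := funext ha
  have hN' : (0 : ℝ) < N := by exact_mod_cast hN
  obtain ⟨m, hm, hmD⟩ := depth_bound hε0 hε1 hq hD
  choose Ψ hl hw hΨ using
    fun y : Fin N → EuclideanSpace ℝ (Fin d) =>
      exists_ann_eulerInterpolation hd m ε⁻¹ (T / N) (N / T) Φ y
  set Z := fun (y : Fin N → EuclideanSpace ℝ (Fin d)) (x : EuclideanSpace ℝ (Fin d)) (k : ℕ) =>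
    eulerGrid (Φ.realize relu) (T / N) y x k with hZ
  have hZs (y x) (n : Fin N) :
      Z y x (n + 1) = Z y x n + ((T / N) • Φ.realize relu (Z y x n) + y n) := by
    simp [hZ, eulerGrid]
  have hts (n : Fin (N + 1)) : N / T * t n = n := by rw [ht]; field_simp
  have hmono (n : Fin N) : t n.castSucc ≤ t n.succ := by
    rw [ht, ht]; gcongr; simp
  have hYt (n : Fin (N + 1)) (x y) : Y (t n) x y = Z y x n := by
    induction n using Fin.induction with
    | zero => rw [ht]; simpa [hZ, eulerGrid] using hY0 x y
    | succ n ih =>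
      have h1 := hts n.succ
      have h2 : t n.succ * N / T - (n : ℕ) = 1 := by
        rw [mul_comm, mul_div_right_comm, h1]; simp
      rw [hY n _ ⟨hmono n, le_rfl⟩, h2, one_smul, ih]
      exact (hZs y x n).symm
  -- On one cell the scheme and the network have the same two-term form with weights `1 - r` and
  -- `r`, so the error and growth bounds reduce to one product each.
  have hrep (n : Fin N) {s : ℝ} (hs : s ∈ Set.Icc (t n.castSucc) (t n.succ)) (x y) :
      ∃ r : ℝ, 0 ≤ r ∧ r ≤ 1 ∧ Y s x y = (1 - r) • Z y x n + r • Z y x (n + 1) ∧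
        ∀ i, (Ψ y).realize relu (timeSpace s x) i = prodApprox m ε⁻¹ (1 - r) (Z y x n i) +
          prodApprox m ε⁻¹ r (Z y x (n + 1) i) := by
    have h1 : (n : ℝ) ≤ N / T * s := by
      have := hts n.castSucc
      rw [Fin.val_castSucc] at this
      rw [← this]; gcongr; exact hs.1
    have h2 : N / T * s ≤ (n : ℝ) + 1 := by
      have := hts n.succ
      rw [Fin.val_succ, Nat.cast_add_one] at this
      rw [← this]; gcongr; exact hs.2
    refine ⟨N / T * s - n, by linarith, by linarith, ?_, fun i => ?_⟩
    · rw [hY n s hs, hYt, hZs, Fin.val_castSucc, show s * N / T = N / T * s by ring]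
      module
    · rw [hΨ, sum_hat n.2 h1 h2 (f := fun h k => prodApprox m ε⁻¹ h (Z y x k i))
        (fun k => prodApprox_zero _ _ _)]
  refine ⟨Ψ, fun y => (Ψ y).continuous_realize continuous_relu, fun n s hs x y => ?_,
    fun n s hs x y => ?_, fun y => ?_, fun s _ x => ?_, fun n s hs x y z hyz => ?_⟩
  · obtain ⟨r, h0, h1, hYs, hR⟩ := hrep n hs x y
    rw [hYt, hYt, hYs, Fin.val_castSucc, Fin.val_succ]
    set u : EuclideanSpace ℝ (Fin d) :=
      WithLp.toLp 2 fun i => (1 - r) * Z y x n i - prodApprox m ε⁻¹ (1 - r) (Z y x n i)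
    set v : EuclideanSpace ℝ (Fin d) :=
      WithLp.toLp 2 fun i => r * Z y x (n + 1) i - prodApprox m ε⁻¹ r (Z y x (n + 1) i)
    have e : (1 - r) • Z y x n + r • Z y x (n + 1) - (Ψ y).realize relu (timeSpace s x) =
        u + v := by
      ext i
      simp only [PiLp.sub_apply, PiLp.add_apply, PiLp.smul_apply, smul_eq_mul, hR, u, v]
      ring
    have hu : ‖u‖ ≤ ε * Real.sqrt d + ε * ‖Z y x n‖ ^ q :=
      EuclideanSpace.norm_le_of_abs_le_rpow hε0.le hε0.le (by linarith) fun i =>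
        (abs_mul_sub_prodApprox hε0 hε1 hq hm (by linarith) (by linarith) _).1
    have hv : ‖v‖ ≤ ε * Real.sqrt d + ε * ‖Z y x (n + 1)‖ ^ q :=
      EuclideanSpace.norm_le_of_abs_le_rpow hε0.le hε0.le (by linarith) fun i =>
        (abs_mul_sub_prodApprox hε0 hε1 hq hm h0 h1 _).1
    rw [e]
    linarith [norm_add_le u v]
  · obtain ⟨r, h0, h1, -, hR⟩ := hrep n hs x y
    rw [hYt, hYt, Fin.val_castSucc, Fin.val_succ]
    set u : EuclideanSpace ℝ (Fin d) :=
      WithLp.toLp 2 fun i => prodApprox m ε⁻¹ (1 - r) (Z y x n i)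
    set v : EuclideanSpace ℝ (Fin d) :=
      WithLp.toLp 2 fun i => prodApprox m ε⁻¹ r (Z y x (n + 1) i)
    have e : (Ψ y).realize relu (timeSpace s x) = u + v := by
      ext i
      exact hR i
    have hu : ‖u‖ ≤ 3 * Real.sqrt d + 2 * ‖Z y x n‖ ^ (2 : ℝ) :=
      EuclideanSpace.norm_le_of_abs_le_rpow (by norm_num) (by norm_num) (by norm_num) fun i =>
        (abs_mul_sub_prodApprox hε0 hε1 hq hm (by linarith) (by linarith) _).2
    have hv : ‖v‖ ≤ 3 * Real.sqrt d + 2 * ‖Z y x (n + 1)‖ ^ (2 : ℝ) :=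
      EuclideanSpace.norm_le_of_abs_le_rpow (by norm_num) (by norm_num) (by norm_num) fun i =>
        (abs_mul_sub_prodApprox hε0 hε1 hq hm h0 h1 _).2
    rw [Real.rpow_two] at hu hv
    rw [e]
    linarith [norm_add_le u v]
  · have hw' : (Ψ y).width ≤ 28 * d + 2 * Φ.params := by
      have := Φ.width_le_params
      have := hw y
      omega
    have hP : 1 ≤ Φ.params := (Φ.input_pos.trans_le Φ.input_le_width).trans_le Φ.width_le_params
    have hp : (Ψ y).params ≤ ((N + 1) * (m + 2 + Φ.hidden) + 1) *
        ((28 * d + 2 * Φ.params) * (28 * d + 2 * Φ.params + 1)) := by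
      refine (Ψ y).params_le.trans ?_
      gcongr
      exact hl y
    refine (Nat.cast_le (α := ℝ).2 hp).trans ?_
    push_cast
    exact params_bound (by exact_mod_cast hN) (by exact_mod_cast hd) (Nat.cast_nonneg m)
      (Nat.cast_nonneg _) (by exact_mod_cast hP) hmD
  · refine (PiLp.continuous_toLp 2 _).comp (continuous_pi fun i => ?_)
    simp only [hΨ]
    refine continuous_finsetSum _ fun k _ => (continuous_prodApprox _ _ _).comp ?_
    exact (EuclideanSpace.proj (𝕜 := ℝ) i).continuous.comp
      (continuous_eulerGrid (Φ.continuous_realize continuous_relu) _ x k)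
  · ext i
    rw [hΨ, hΨ]
    refine Finset.sum_congr rfl fun k _ => ?_
    -- Grid value `k ≤ n` uses only the first `k` increments; for `k > n` the hat vanishes up to
    -- time `t n`.
    rcases le_or_gt k n with hk | hk
    · rw [eulerGrid_congr _ _ _ fun j hj => hyz j (hj.trans_le hk)]
    · have h1 : N / T * s ≤ n := by rw [← hts n]; gcongr; exact hs.2
      have h2 : (n : ℝ) + 1 ≤ k := by exact_mod_cast hk
      rw [hat_of_le (by linarith), prodApprox_zero, prodApprox_zero]
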